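/- Let $n\ge 2$, $\sigma>0$, $\mu\in\mathbb{R}$, and let $X_1,\dots,X_n$ be i.i.d. $\mathrm{N}(\mu,\sigma^2)$ random variables. Consider the normal model with parameter $\theta=(\theta_1,\theta_2)=(\text{mean},\text{variance})\in\Theta=\mathbb{R}\times(0,\infty)$, likelihood $L(\theta;x)=\prod_{i=1}^n (2\pi\theta_2)^{-1/2}e^{-(x_i-\theta_1)^2/(2\theta_2)}$, and the test of $H_0:\mu=0$, that is, $\Theta_0=\{\theta\in\Theta:\theta_1=0\}$, against the general alternative $\theta\in\Theta$. Almost surely, $L(\cdot;X)$ has a unique maximiser over $\Theta$, namely $\hat\theta_n(X)=\bigl(\bar X,\frac1n\sum_{i=1}^n(X_i-\bar X)^2\bigr)$ with $\bar X=\frac1n\sum_{i=1}^n X_i$, and a unique maximiser over $\Theta_0$, namely $\hat\theta^{\mathrm{res}}(X)=\bigl(0,\frac1n\sum_{i=1}^nX_i^2\bigr)$. Let $$-2\log\Lambda = 2\log\frac{T_1}{T_2},\qquad T_1=\frac{L(\hat\theta_n(X);X)}{L((\mu,\sigma^2);X)},\quad T_2=\frac{L(\hat\theta^{\mathrm{res}}(X);X)}{L((\mu,\sigma^2);X)},$$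 be the log-likelihood ratio statistic. If $H_0$ holds, i.e. $\mu=0$, then for $K\sim\chi^2_1$ and every bounded, twice continuously differentiable $h:\mathbb{R}\to\mathbb{R}$ with bounded first and second derivatives, $$\bigl|\mathbb{E}[h(-2\log\Lambda)]-\mathbb{E}[h(K)]\bigr|\le \frac{47456\,\sigma^2\,(\|h''\|+\|h'\|)}{\sqrt{n\pi}}\max\{1,\sigma^{-9}\}+418433114\,\frac{\|h'\|}{\sqrt n}\max\{1,\sigma^4\}+8\,\frac{\|h\|}{n}\Bigl(4+\frac1{\sigma^2}\Bigr),$$ where $\|\cdot\|$ denotes the supremum norm on $\mathbb{R}$. -/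

import Mathlib

open MeasureTheory ProbabilityTheory

noncomputable section

namespace LikelihoodRatio

/-- The likelihood `L(θ; x) = ∏ i, f (xᵢ | θ)` of a sample `x`, for a parametric family of
densities `f x θ`. -/
def likelihood {𝒳 Param : Type*} {n : ℕ} (f : 𝒳 → Param → ℝ) (x : Fin n → 𝒳) (θ : Param) : ℝ :=
  ∏ i, f (x i) θ

/-- The set of maximum likelihood estimates over the parameter set `S`: all points of `S` at
which the likelihood attains its maximum over `S`. -/
def mleSet {𝒳 Param : Type*} {n : ℕ} (f : 𝒳 → Param → ℝ) (S : Set Param) (x : Fin n → 𝒳) :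
    Set Param :=
  {θ | θ ∈ S ∧ IsMaxOn (likelihood f x) S θ}

/-- The maximum likelihood estimate over `S`, `argmax_{θ ∈ S} L(θ; x)`: an element of `mleSet`
(an unspecified parameter if there is none). -/
def mle {𝒳 Param : Type*} [Nonempty Param] {n : ℕ} (f : 𝒳 → Param → ℝ) (S : Set Param)
    (x : Fin n → 𝒳) : Param :=
  Classical.epsilon fun θ => θ ∈ mleSet f S x

/-- The likelihood ratio `L(θ̂_S(x); x) / L(θ₀; x)` of the maximum likelihood estimate over `S`
against the parameter `θ₀`. -/
def maxLikelihoodRatio {𝒳 Param : Type*} [Nonempty Param] {n : ℕ} (f : 𝒳 → Param → ℝ)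
    (S : Set Param) (θ₀ : Param) (x : Fin n → 𝒳) : ℝ :=
  likelihood f x (mle f S x) / likelihood f x θ₀

/-- The log-likelihood ratio statistic `-2 log Λ = 2 log (T₁ / T₂)` for testing `θ ∈ S₀` against
`θ ∈ S`, where `T₁` and `T₂` are the ratios of the likelihoods maximised over `S` and over `S₀`
to the likelihood at the true parameter `θ₀`. -/
def negTwoLogLambda {𝒳 Param : Type*} [Nonempty Param] {n : ℕ} (f : 𝒳 → Param → ℝ)
    (S S₀ : Set Param) (θ₀ : Param) (x : Fin n → 𝒳) : ℝ :=
  2 * Real.log (maxLikelihoodRatio f S θ₀ x / maxLikelihoodRatio f S₀ θ₀ x)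

/-- The density of the normal distribution, with parameter `θ = (mean, variance)`. -/
def normalDensity (x : ℝ) (θ : ℝ × ℝ) : ℝ :=
  gaussianPDFReal θ.1 θ.2.toNNReal x

/-- The parameter space `ℝ × (0, ∞)` of the normal model. -/
def normalParams : Set (ℝ × ℝ) := {θ | 0 < θ.2}

/-- The parameters of the normal model that satisfy the null hypothesis `mean = 0`. -/
def normalNullParams : Set (ℝ × ℝ) := {θ | θ ∈ normalParams ∧ θ.1 = 0}

/-- The sample mean. -/
def sampleMean {n : ℕ} (x : Fin n → ℝ) : ℝ := (∑ i, x i) / n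

/-- The chi-square distribution with `r` degrees of freedom: the law of the sum of the squares of
`r` independent standard normal random variables. -/
def chiSquared (r : ℕ) : Measure ℝ :=
  (Measure.pi fun _ : Fin r => gaussianReal 0 1).map fun z => ∑ i, z i ^ 2

/-- `h` is bounded and twice continuously differentiable, with bounded first and second
derivatives. -/
structure IsCb2 (h : ℝ → ℝ) : Prop where
  contDiff : ContDiff ℝ 2 h
  bounded : ∃ C, ∀ x, |h x| ≤ C
  bounded_deriv : ∃ C, ∀ x, |deriv h x| ≤ C
  bounded_deriv2 : ∃ C, ∀ x, |deriv (deriv h) x| ≤ C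

/-- The supremum norm of a bounded real function. -/
def supNorm (g : ℝ → ℝ) : ℝ := ⨆ x, |g x|

end LikelihoodRatio

end

namespace LikelihoodRatio

/-! Put `Y i = X i / σ`, `Q = ∑ Y i ^ 2`, `Z = (∑ Y i) / √n`. Inserting the two maximisers shows
that the statistic is almost surely `n * log (Q / (Q - Z ^ 2))`, in which `σ` has cancelled. Under
the null hypothesis `Z` is exactly standard normal, so `Z ^ 2` already has the chi-square law and no
central limit estimate is needed; only the replacement of the logarithm by `Z ^ 2` costs anything.

That cost is bounded pointwise by a polynomial in `Z` and `Q - n` (`IsCb2.abs_comp_sub_le`).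
Integrating with `E Z ^ 4 = 3`, `E Z ^ 2 = 1`, `E (Q - n) ^ 2 = 2 * n` gives `29 ‖h'‖ / √n + 24 ‖h‖
/ n` (`abs_integral_sub_le`), which lies below the last two terms of the claimed bound. -/

/-! ### Maximum likelihood in the normal model and the closed form of the statistic -/

lemma likelihood_normalDensity {n : ℕ} (x : Fin n → ℝ) {θ : ℝ × ℝ} (hθ : 0 < θ.2) :
    likelihood normalDensity x θ =
      Real.exp (-(n / 2 * Real.log (2 * Real.pi * θ.2)) - (∑ i, (x i - θ.1) ^ 2) / (2 * θ.2)) := by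
  have hpos : 0 < 2 * Real.pi * θ.2 := by positivity
  have hsqrt : (√(2 * Real.pi * θ.2))⁻¹ = Real.exp (-(1 / 2 * Real.log (2 * Real.pi * θ.2))) := by
    rw [Real.exp_neg, Real.sqrt_eq_rpow, Real.rpow_def_of_pos hpos, mul_comm]
  simp only [likelihood, normalDensity, gaussianPDFReal, Real.coe_toNNReal _ hθ.le, hsqrt,
    ← Real.exp_add, ← Real.exp_sum]
  congr 1
  rw [Finset.sum_add_distrib, Finset.sum_div, Finset.sum_const]
  simp only [neg_div, Finset.sum_neg_distrib, Finset.card_univ, Fintype.card_fin, nsmul_eq_mul]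
  ring

lemma likelihood_normalDensity_pos {n : ℕ} (x : Fin n → ℝ) {θ : ℝ × ℝ} (hθ : 0 < θ.2) :
    0 < likelihood normalDensity x θ := by
  rw [likelihood_normalDensity x hθ]
  exact Real.exp_pos _

/-- With `A`, `B` the residual sums at `m` and `θ.1`, and `u = A / (n * θ.2)`, the log-likelihood
gap is `n / 2 * (u - 1 - log u) + (B - A) / (2 * θ.2)`. Both terms are nonnegative and vanish
together only at the claimed point. Keeping `S` abstract serves the full and the null model at once.
-/
lemma mleSet_normalDensity_eq_singleton {n : ℕ} (hn : 0 < n) (x : Fin n → ℝ) {S : Set (ℝ × ℝ)}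
    (hS : S ⊆ normalParams) (m : ℝ) (hpos : 0 < ∑ i, (x i - m) ^ 2)
    (hmem : (m, (∑ i, (x i - m) ^ 2) / n) ∈ S)
    (hle : ∀ θ ∈ S, ∑ i, (x i - m) ^ 2 ≤ ∑ i, (x i - θ.1) ^ 2)
    (heq : ∀ θ ∈ S, ∑ i, (x i - θ.1) ^ 2 ≤ ∑ i, (x i - m) ^ 2 → θ.1 = m) :
    mleSet normalDensity S x = {(m, (∑ i, (x i - m) ^ 2) / n)} := by
  have hn' : (0 : ℝ) < n := by exact_mod_cast hn
  set A := ∑ i, (x i - m) ^ 2 with hA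
  have hv : 0 < A / n := by positivity
  have key : ∀ θ ∈ S, likelihood normalDensity x θ ≤ likelihood normalDensity x (m, A / n) ∧
      (likelihood normalDensity x (m, A / n) ≤ likelihood normalDensity x θ →
        θ = (m, A / n)) := by
    intro θ hθS
    have hθ : 0 < θ.2 := hS hθS
    have h1 := hle θ hθS
    rw [likelihood_normalDensity x hθ, likelihood_normalDensity x (θ := (m, A / n)) hv,
      Real.exp_le_exp, Real.exp_le_exp]
    simp only [← hA]
    set B := ∑ i, (x i - θ.1) ^ 2
    have e1 : A / (2 * (A / n)) = n / 2 := by field_simp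
    have e2 : B / (2 * θ.2) = n / 2 * (A / n / θ.2) + (B - A) / (2 * θ.2) := by
      field_simp
      ring
    have e3 : Real.log (2 * Real.pi * (A / n)) =
        Real.log (2 * Real.pi * θ.2) + Real.log (A / n / θ.2) := by
      rw [← Real.log_mul (by positivity) (by positivity)]
      congr 1
      field_simp
    rw [e1, e2, e3]
    have hu : 0 < A / n / θ.2 := by positivity
    have h2 := Real.log_le_sub_one_of_pos hu
    have h3 : 0 ≤ (B - A) / (2 * θ.2) := div_nonneg (by linarith) (by positivity)
    have h4 := mul_le_mul_of_nonneg_left h2 (by positivity : (0 : ℝ) ≤ n / 2)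
    refine ⟨by linarith, fun h5 => ?_⟩
    have h6 : (B - A) / (2 * θ.2) = 0 := by linarith
    have h7 : B - A = 0 := by
      rcases div_eq_zero_iff.1 h6 with h | h
      · exact h
      · exact absurd h (by positivity)
    have h8 : A / n / θ.2 = 1 := by
      by_contra hne
      have := mul_lt_mul_of_pos_left (Real.log_lt_sub_one_of_pos hu hne)
        (by positivity : (0 : ℝ) < n / 2)
      linarith
    have h9 : A / n = θ.2 := by rwa [div_eq_one_iff_eq hθ.ne'] at h8
    exact Prod.ext (heq θ hθS (by linarith)) h9.symm
  ext θ
  simp only [mleSet, Set.mem_ofPred_eq, Set.mem_singleton_iff]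
  constructor
  · rintro ⟨h1, h2⟩
    exact (key θ h1).2 (h2 hmem)
  · rintro rfl
    exact ⟨hmem, fun θ hθ => (key θ hθ).1⟩

lemma sum_sub_sq_eq {n : ℕ} (hn : 0 < n) (x : Fin n → ℝ) (m : ℝ) :
    ∑ i, (x i - m) ^ 2 =
      ∑ i, (x i - sampleMean x) ^ 2 + n * (sampleMean x - m) ^ 2 := by
  have hn' : (n : ℝ) ≠ 0 := by exact_mod_cast hn.ne'
  have h : ∑ i, x i = n * sampleMean x := by
    rw [sampleMean]
    field_simp
  have e : ∀ c : ℝ, ∑ i, (x i - c) ^ 2 = ∑ i, x i ^ 2 - 2 * c * ∑ i, x i + n * c ^ 2 := by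
    intro c
    simp_rw [sub_sq]
    rw [Finset.sum_add_distrib, Finset.sum_sub_distrib, Finset.mul_sum]
    simp only [Finset.sum_const, Finset.card_univ, Fintype.card_fin, nsmul_eq_mul]
    congr 2
    exact Finset.sum_congr rfl fun i _ => by ring
  rw [e, e, h]
  ring

lemma mleSet_normalParams {n : ℕ} (hn : 0 < n) (x : Fin n → ℝ)
    (hpos : 0 < ∑ i, (x i - sampleMean x) ^ 2) :
    mleSet normalDensity normalParams x =
      {(sampleMean x, (∑ i, (x i - sampleMean x) ^ 2) / n)} := by
  have hn' : (0 : ℝ) < n := by exact_mod_cast hn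
  refine mleSet_normalDensity_eq_singleton hn x subset_rfl _ hpos
    (show 0 < (∑ i, (x i - sampleMean x) ^ 2) / n by positivity) (fun θ _ => ?_) fun θ _ h => ?_
  · rw [sum_sub_sq_eq hn x θ.1]
    exact le_add_of_nonneg_right (by positivity)
  · rw [sum_sub_sq_eq hn x θ.1] at h
    have h0 : (sampleMean x - θ.1) ^ 2 ≤ 0 := by
      by_contra! hc
      have := mul_pos hn' hc
      linarith
    have := pow_eq_zero_iff two_ne_zero |>.1 (le_antisymm h0 (sq_nonneg _))
    linarith

lemma sum_sub_sampleMean_sq_le {n : ℕ} (hn : 0 < n) (x : Fin n → ℝ) :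
    ∑ i, (x i - sampleMean x) ^ 2 ≤ ∑ i, x i ^ 2 := by
  have := sum_sub_sq_eq hn x 0
  simp only [sub_zero] at this
  rw [this]
  exact le_add_of_nonneg_right (by positivity)

lemma mleSet_normalNullParams {n : ℕ} (hn : 0 < n) (x : Fin n → ℝ) (hpos : 0 < ∑ i, x i ^ 2) :
    mleSet normalDensity normalNullParams x = {((0 : ℝ), (∑ i, x i ^ 2) / n)} := by
  have hn' : (0 : ℝ) < n := by exact_mod_cast hn
  have := mleSet_normalDensity_eq_singleton hn x (S := normalNullParams) (fun θ h => h.1) 0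
    (by simpa using hpos)
    ⟨show (0 : ℝ) < (∑ i, (x i - 0) ^ 2) / n by simp only [sub_zero]; positivity, rfl⟩
    (fun θ h => by rw [h.2]) fun θ h _ => h.2
  simpa using this

lemma mle_eq_of_mleSet_eq_singleton {𝒳 Param : Type*} [Nonempty Param] {n : ℕ}
    {f : 𝒳 → Param → ℝ} {S : Set Param} {x : Fin n → 𝒳} {θ : Param}
    (h : mleSet f S x = {θ}) : mle f S x = θ := by
  have : mle f S x ∈ mleSet f S x := Classical.epsilon_spec (p := fun θ => θ ∈ mleSet f S x)
    ⟨θ, by rw [h]; rfl⟩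
  rwa [h] at this

lemma negTwoLogLambda_normal {n : ℕ} (hn : 0 < n) (x : Fin n → ℝ) {θ₀ : ℝ × ℝ} (hθ₀ : 0 < θ₀.2)
    (hpos : 0 < ∑ i, (x i - sampleMean x) ^ 2) :
    negTwoLogLambda normalDensity normalParams normalNullParams θ₀ x =
      n * Real.log ((∑ i, x i ^ 2) / ∑ i, (x i - sampleMean x) ^ 2) := by
  have hn' : (0 : ℝ) < n := by exact_mod_cast hn
  have hpos' : 0 < ∑ i, x i ^ 2 := hpos.trans_le (sum_sub_sampleMean_sq_le hn x)
  have hL₀ := likelihood_normalDensity_pos x hθ₀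
  rw [negTwoLogLambda, maxLikelihoodRatio, maxLikelihoodRatio,
    mle_eq_of_mleSet_eq_singleton (mleSet_normalParams hn x hpos),
    mle_eq_of_mleSet_eq_singleton (mleSet_normalNullParams hn x hpos'),
    div_div_div_cancel_right₀ hL₀.ne']
  set s := ∑ i, (x i - sampleMean x) ^ 2 with hs
  set q := ∑ i, x i ^ 2 with hq
  rw [likelihood_normalDensity x (θ := (sampleMean x, s / n)) (by positivity),
    likelihood_normalDensity x (θ := (0, q / n)) (by positivity), ← Real.exp_sub, Real.log_exp]
  simp only [sub_zero, ← hs, ← hq]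
  rw [Real.log_mul (by positivity) (div_pos hpos hn').ne',
    Real.log_mul (by positivity) (div_pos hpos' hn').ne', Real.log_div hpos.ne' hn'.ne', Real.log_div hpos'.ne' hn'.ne', Real.log_div hpos'.ne' hpos.ne']
  have e1 : s / (2 * (s / n)) = n / 2 := by field_simp
  have e2 : q / (2 * (q / n)) = n / 2 := by field_simp
  rw [e1, e2]
  ring

/-! ### Pointwise comparison of the statistic with its linearisation -/

/-- Either the logarithm is close to its linearisation, or one of `q` and `z` is far from its
typical size. -/
lemma abs_mul_log_div_sub_le_or {n z q : ℝ} (hn : 0 < n) (hz : 0 ≤ z) (hzq : z < q) :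
    |n * Real.log (q / (q - z)) - z| ≤
        8 * z ^ 2 / n + (z ^ 2 + (q - n) ^ 2 / n) / √n ∨
      1 ≤ 4 * (q - n) ^ 2 / n ^ 2 + 4 * z / n := by
  by_cases hq : q < n / 2
  · right
    have h1 : 1 ≤ 4 * (q - n) ^ 2 / n ^ 2 := by
      rw [le_div_iff₀ (by positivity)]
      nlinarith
    have : 0 ≤ 4 * z / n := by positivity
    linarith
  by_cases hz' : n / 4 < z
  · right
    have h1 : 1 ≤ 4 * z / n := by
      rw [le_div_iff₀ (by positivity)]
      linarith
    have : 0 ≤ 4 * (q - n) ^ 2 / n ^ 2 := by positivity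
    linarith
  left
  push Not at hq hz'
  have hq0 : 0 < q := by linarith
  have hs : 0 < q - z := by linarith
  have hlow : z / q ≤ Real.log (q / (q - z)) := by
    have := Real.one_sub_inv_le_log_of_pos (show 0 < q / (q - z) by positivity)
    refine le_trans (le_of_eq ?_) this
    field_simp
    ring
  have hup : Real.log (q / (q - z)) ≤ z / (q - z) := by
    have := Real.log_le_sub_one_of_pos (show 0 < q / (q - z) by positivity)
    refine le_trans this (le_of_eq ?_)
    field_simp
    ring
  have h1 : |n * Real.log (q / (q - z)) - n * (z / q)| ≤ 8 * z ^ 2 / n := by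
    rw [← mul_sub, abs_mul, abs_of_pos hn, abs_of_nonneg (by linarith)]
    have h2 : z / (q - z) - z / q = z ^ 2 / ((q - z) * q) := by
      field_simp
      ring
    -- Here `q ≥ n / 2` and `q - z ≥ n / 4`.
    have h3 : z ^ 2 / ((q - z) * q) ≤ z ^ 2 / (n ^ 2 / 8) := by
      apply div_le_div_of_nonneg_left (by positivity) (by positivity)
      nlinarith
    calc n * (Real.log (q / (q - z)) - z / q) ≤ n * (z ^ 2 / (n ^ 2 / 8)) := by
          gcongr
          linarith
      _ = 8 * z ^ 2 / n := by field_simp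
  -- The product `z * |q - n|` is split by `2ab ≤ a² + b²`, so that only separate moments of `z` and
  -- `q` are needed, not joint ones.
  have h2 : |n * (z / q) - z| ≤ (z ^ 2 + (q - n) ^ 2 / n) / √n := by
    have hr : 0 < √n := Real.sqrt_pos.2 hn
    have e : n * (z / q) - z = z * (n - q) / q := by field_simp
    rw [e, abs_div, abs_mul, abs_of_nonneg hz, abs_of_pos hq0]
    calc z * |n - q| / q ≤ z * |n - q| / (n / 2) := by gcongr
      _ = 2 * z * (|n - q| / √n) / √n := by
          rw [div_eq_div_iff (by positivity) (by positivity)]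
          field_simp
          rw [Real.sq_sqrt hn.le]
          ring
      _ ≤ (z ^ 2 + (|n - q| / √n) ^ 2) / √n := by
          gcongr
          exact two_mul_le_add_sq _ _
      _ = (z ^ 2 + (q - n) ^ 2 / n) / √n := by
          rw [div_pow, sq_abs, Real.sq_sqrt hn.le, ← neg_sub q n, neg_sq]
  calc |n * Real.log (q / (q - z)) - z|
      ≤ |n * Real.log (q / (q - z)) - n * (z / q)| + |n * (z / q) - z| := abs_sub_le _ _ _
    _ ≤ _ := add_le_add h1 h2

lemma abs_le_supNorm {g : ℝ → ℝ} (hg : ∃ C, ∀ x, |g x| ≤ C) (x : ℝ) : |g x| ≤ supNorm g := by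
  obtain ⟨C, hC⟩ := hg
  exact le_ciSup (f := fun x => |g x|) ⟨C, by rintro _ ⟨y, rfl⟩; exact hC y⟩ x

lemma supNorm_nonneg (g : ℝ → ℝ) : 0 ≤ supNorm g := Real.iSup_nonneg fun _ => abs_nonneg _

lemma IsCb2.abs_sub_le {h : ℝ → ℝ} (hh : IsCb2 h) (a b : ℝ) :
    |h a - h b| ≤ supNorm (deriv h) * |a - b| :=
  Convex.norm_image_sub_le_of_norm_deriv_le
    (fun x _ => (hh.contDiff.differentiable (by norm_num)).differentiableAt)
    (fun x _ => abs_le_supNorm hh.bounded_deriv x) convex_univ (Set.mem_univ b) (Set.mem_univ a)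

/-- Near the linearisation `h` is controlled by its Lipschitz constant, otherwise by `2 ‖h‖` times a
quantity at least `1`. Adding both bounds builds Markov's inequality into a pointwise estimate,
ready to integrate. -/
lemma IsCb2.abs_comp_sub_le {h : ℝ → ℝ} (hh : IsCb2 h) {n z q : ℝ} (hn : 0 < n) (hz : 0 ≤ z)
    (hzq : z < q) :
    |h (n * Real.log (q / (q - z))) - h z| ≤
      supNorm (deriv h) * (8 * z ^ 2 / n + (z ^ 2 + (q - n) ^ 2 / n) / √n) +
        2 * supNorm h * (4 * (q - n) ^ 2 / n ^ 2 + 4 * z / n) := by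
  have h0 := supNorm_nonneg h
  have h1 := supNorm_nonneg (deriv h)
  rcases abs_mul_log_div_sub_le_or hn hz hzq with H | H
  · calc _ ≤ supNorm (deriv h) * |n * Real.log (q / (q - z)) - z| := hh.abs_sub_le _ _
      _ ≤ supNorm (deriv h) * (8 * z ^ 2 / n + (z ^ 2 + (q - n) ^ 2 / n) / √n) := by gcongr
      _ ≤ _ := le_add_of_nonneg_right (by positivity)
  · calc _ ≤ |h (n * Real.log (q / (q - z)))| + |h z| := abs_sub _ _
      _ ≤ 2 * supNorm h * 1 := by
        linarith [abs_le_supNorm hh.bounded (n * Real.log (q / (q - z))),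
          abs_le_supNorm hh.bounded z]
      _ ≤ 2 * supNorm h * (4 * (q - n) ^ 2 / n ^ 2 + 4 * z / n) := by gcongr
      _ ≤ _ := le_add_of_nonneg_left (by positivity)


/-! ### Gaussian moments -/

lemma integral_pow_four_gaussianReal : ∫ x, x ^ 4 ∂gaussianReal 0 1 = 3 := by
  have h0 : (0 : ℝ) ∈ interior (integrableExpSet id (gaussianReal 0 1)) := by simp
  have h := iteratedDeriv_mgf_zero h0 4
  have hm : mgf id (gaussianReal 0 1) = fun t : ℝ => Real.exp (t ^ 2 / 2) := by
    rw [mgf_id_gaussianReal]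
    simp
  -- Differentiating `p * exp (t ^ 2 / 2)` sends `p` to `p' + t * p`; four rounds from `p = 1` give
  -- the value `3` at `0`.
  have hd : ∀ (p p' : ℝ → ℝ), (∀ t, HasDerivAt p (p' t) t) →
      deriv (fun t : ℝ => p t * Real.exp (t ^ 2 / 2)) =
        fun t => (p' t + t * p t) * Real.exp (t ^ 2 / 2) := by
    intro p p' hp
    funext t
    have he : HasDerivAt (fun t : ℝ => Real.exp (t ^ 2 / 2)) (Real.exp (t ^ 2 / 2) * t) t := by
      have : HasDerivAt (fun t : ℝ => t ^ 2 / 2) t t := by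
        convert! (hasDerivAt_pow 2 t).div_const 2 using 1
        simp
      exact this.exp
    refine ((hp t).mul he).deriv.trans ?_
    ring
  have d1 : deriv (fun t : ℝ => Real.exp (t ^ 2 / 2)) = fun t => t * Real.exp (t ^ 2 / 2) := by
    simpa using hd (fun _ => 1) (fun _ => 0) fun t => hasDerivAt_const t 1
  have d2 := hd (fun t => t) (fun _ => 1) fun t => hasDerivAt_id t
  have d3 := hd (fun t => 1 + t * t) (fun t => 2 * t) fun t => by
    convert! ((hasDerivAt_id t).mul (hasDerivAt_id t)).const_add 1 using 1
    simp
    ring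
  have d4 := hd (fun t => 2 * t + t * (1 + t * t)) (fun t => 3 + 3 * t ^ 2) fun t => by
    convert! ((hasDerivAt_id t).const_mul 2).add
      ((hasDerivAt_id t).mul (((hasDerivAt_id t).mul (hasDerivAt_id t)).const_add 1)) using 1
    simp
    ring
  rw [hm] at h
  simp only [iteratedDeriv_succ, iteratedDeriv_zero, d1, d2, d3, d4] at h
  simpa using h.symm

lemma integral_sq_gaussianReal : ∫ x, x ^ 2 ∂gaussianReal 0 1 = 1 := by
  have h := variance_of_integral_eq_zero (μ := gaussianReal 0 1) (X := fun x => x)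
    aemeasurable_id integral_id_gaussianReal
  rw [variance_fun_id_gaussianReal] at h
  simpa using h.symm

lemma integrable_pow_gaussianReal (k : ℕ) : Integrable (fun x => x ^ k) (gaussianReal 0 1) :=
  integrable_pow_of_mem_interior_integrableExpSet (X := id) (by simp) k

section Moments

variable {Ω : Type*} [MeasurableSpace Ω] {P : Measure Ω}

lemma integrable_pow_of_hasLaw {Z : Ω → ℝ} (hZ : HasLaw Z (gaussianReal 0 1) P) (k : ℕ) :
    Integrable (fun ω => Z ω ^ k) P := by
  have := integrable_pow_gaussianReal k
  rw [← hZ.map_eq] at this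
  exact this.comp_aemeasurable hZ.aemeasurable

lemma integral_sq_of_hasLaw {Z : Ω → ℝ} (hZ : HasLaw Z (gaussianReal 0 1) P) :
    ∫ ω, Z ω ^ 2 ∂P = 1 :=
  (hZ.integral_comp (f := fun x => x ^ 2) (by fun_prop)).trans integral_sq_gaussianReal

lemma integral_pow_four_of_hasLaw {Z : Ω → ℝ} (hZ : HasLaw Z (gaussianReal 0 1) P) :
    ∫ ω, Z ω ^ 4 ∂P = 3 :=
  (hZ.integral_comp (f := fun x => x ^ 4) (by fun_prop)).trans integral_pow_four_gaussianReal

lemma memLp_sq_of_hasLaw {Z : Ω → ℝ} (hZ : HasLaw Z (gaussianReal 0 1) P) :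
    MemLp (fun ω => Z ω ^ 2) 2 P := by
  have hm : AEStronglyMeasurable (fun ω => Z ω ^ 2) P :=
    (hZ.aemeasurable.pow_const 2).aestronglyMeasurable
  rw [memLp_two_iff_integrable_sq hm]
  simpa only [← pow_mul] using integrable_pow_of_hasLaw hZ 4

lemma variance_sq_of_hasLaw [IsProbabilityMeasure P] {Z : Ω → ℝ} (hZ : HasLaw Z (gaussianReal 0 1) P) :
    Var[fun ω => Z ω ^ 2; P] = 2 := by
  rw [variance_eq_sub (memLp_sq_of_hasLaw hZ), integral_sq_of_hasLaw hZ]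
  simp only [Pi.pow_apply, ← pow_mul]
  rw [integral_pow_four_of_hasLaw hZ]
  norm_num

variable {n : ℕ} {Y : Fin n → Ω → ℝ}

lemma memLp_sum_sq (hlaw : ∀ i, HasLaw (Y i) (gaussianReal 0 1) P) :
    MemLp (fun ω => ∑ i, Y i ω ^ 2) 2 P :=
  memLp_finsetSum _ fun i _ => memLp_sq_of_hasLaw (hlaw i)

lemma integral_sum_sq (hlaw : ∀ i, HasLaw (Y i) (gaussianReal 0 1) P) :
    ∫ ω, ∑ i, Y i ω ^ 2 ∂P = n := by
  rw [integral_finsetSum _ fun i _ => integrable_pow_of_hasLaw (hlaw i) 2]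
  simp [integral_sq_of_hasLaw (hlaw _)]

lemma integral_sum_sq_sub_sq [IsProbabilityMeasure P] (hY : iIndepFun Y P)
    (hlaw : ∀ i, HasLaw (Y i) (gaussianReal 0 1) P) :
    ∫ ω, (∑ i, Y i ω ^ 2 - n) ^ 2 ∂P = 2 * n := by
  have h := IndepFun.variance_sum (μ := P) (s := Finset.univ) (X := fun i ω => Y i ω ^ 2)
    (fun i _ => memLp_sq_of_hasLaw (hlaw i)) fun i _ j _ hij =>
      (hY.indepFun hij).comp (measurable_id.pow_const 2) (measurable_id.pow_const 2)
  simp only [variance_sq_of_hasLaw (hlaw _)] at h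
  rw [variance_eq_integral (Finset.aemeasurable_sum _ fun i _ =>
    (hlaw i).aemeasurable.pow_const 2)] at h
  simp only [Finset.sum_apply, integral_sum_sq hlaw] at h
  rw [h]
  simp [mul_comm]

lemma hasLaw_sum_div_sqrt (hn : 0 < n) (hY : iIndepFun Y P)
    (hlaw : ∀ i, HasLaw (Y i) (gaussianReal 0 1) P) :
    HasLaw (fun ω => (∑ i, Y i ω) / √n) (gaussianReal 0 1) P := by
  have hn' : (0 : ℝ) < n := by exact_mod_cast hn
  have hG : ∀ i, HasGaussianLaw (Y i) P := fun i => ⟨by rw [(hlaw i).map_eq]; infer_instance⟩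
  have hS := hY.hasGaussianLaw_fun_sum hG
  have hmean : ∀ i, ∫ ω, Y i ω ∂P = 0 := fun i => by
    rw [(hlaw i).integral_eq, integral_id_gaussianReal]
  have hint : ∀ i, Integrable (Y i) P := fun i => by
    simpa using integrable_pow_of_hasLaw (hlaw i) 1
  have hL2 : ∀ i, MemLp (Y i) 2 P := fun i =>
    (memLp_two_iff_integrable_sq (hint i).aestronglyMeasurable).2
      (integrable_pow_of_hasLaw (hlaw i) 2)
  have hmS : ∫ ω, ∑ i, Y i ω ∂P = 0 := by
    rw [integral_finsetSum _ fun i _ => hint i]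
    simp [hmean]
  have hvS : Var[fun ω => ∑ i, Y i ω; P] = n := by
    have h := IndepFun.variance_sum (μ := P) (s := Finset.univ) (X := Y)
      (fun i _ => hL2 i) fun i _ j _ hij => hY.indepFun hij
    have e : (∑ i, Y i) = fun ω => ∑ i, Y i ω := by
      ext
      simp
    rw [← e, h]
    simp [(hlaw _).variance_eq]
  have hlawS : HasLaw (fun ω => ∑ i, Y i ω) (gaussianReal 0 n) P := by
    refine ⟨hS.aemeasurable, ?_⟩
    rw [hS.map_eq_gaussianReal, hmS, hvS]
    simp
  have := gaussianReal_div_const hlawS √n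
  convert! this using 2
  · simp
  · ext
    simp [Real.sq_sqrt hn'.le, hn'.ne']

end Moments

/-! ### The sample is almost surely not constant -/

section Nondegenerate

variable {Ω : Type*} [MeasurableSpace Ω] {P : Measure Ω}

lemma ae_ne_of_indepFun {U V : Ω → ℝ} {ν ρ : Measure ℝ} [IsProbabilityMeasure P]
    [NullSingletonClass ρ] (hU : HasLaw U ν P) (hV : HasLaw V ρ P) (h : IndepFun U V P) :
    ∀ᵐ ω ∂P, U ω ≠ V ω := by
  have : IsProbabilityMeasure ν := hU.isProbabilityMeasure_iff.1 ‹_›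
  have : IsProbabilityMeasure ρ := hV.isProbabilityMeasure_iff.1 ‹_›
  have hp := h.hasLaw_prod hU hV
  have hms : MeasurableSet {p : ℝ × ℝ | p.1 ≠ p.2} :=
    (measurableSet_eq_fun measurable_fst measurable_snd).compl
  refine (hp.ae_iff (p := fun p => p.1 ≠ p.2) (measurableSet_setOfPred.1 hms)).2 ?_
  rw [Measure.ae_prod_iff_ae_ae hms]
  refine Filter.Eventually.of_forall fun x => ?_
  filter_upwards [compl_mem_ae_iff.2 (measure_singleton (μ := ρ) x)] with y hy using Ne.symm hy

/-- A vanishing sum would force the first two observations to coincide, a null event for independent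
atomless variables. -/
lemma ae_sum_sub_sampleMean_sq_pos [IsProbabilityMeasure P] {n : ℕ} (hn : 2 ≤ n)
    {X : Fin n → Ω → ℝ} (hX : iIndepFun X P) {ρ : Measure ℝ} [NullSingletonClass ρ]
    (hlaw : ∀ i, HasLaw (X i) ρ P) :
    ∀ᵐ ω ∂P, 0 < ∑ i, (X i ω - sampleMean (fun j => X j ω)) ^ 2 := by
  let a : Fin n := ⟨0, by omega⟩
  let b : Fin n := ⟨1, by omega⟩
  have hab : a ≠ b := by simp [a, b]
  filter_upwards [ae_ne_of_indepFun (hlaw a) (hlaw b) (hX.indepFun hab)] with ω hω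
  refine lt_of_le_of_ne (Finset.sum_nonneg fun i _ => sq_nonneg _) fun h => hω ?_
  have h0 := (Finset.sum_eq_zero_iff_of_nonneg fun i _ => sq_nonneg _).1 h.symm
  have ha := pow_eq_zero_iff two_ne_zero |>.1 (h0 a (Finset.mem_univ _))
  have hb := pow_eq_zero_iff two_ne_zero |>.1 (h0 b (Finset.mem_univ _))
  linarith

end Nondegenerate

/-! ### Distance to the chi-square law -/

lemma chiSquared_one : chiSquared 1 = (gaussianReal 0 1).map fun x => x ^ 2 := by
  have h := (measurePreserving_eval (fun _ : Fin 1 => gaussianReal 0 1) 0).map_eq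
  conv_rhs => rw [← h, Measure.map_map (by fun_prop) (by fun_prop)]
  rw [chiSquared]
  congr 1
  ext z
  simp

lemma IsCb2.integrable_comp {Ω : Type*} [MeasurableSpace Ω] {P : Measure Ω} [IsFiniteMeasure P]
    {h : ℝ → ℝ} (hh : IsCb2 h) {W : Ω → ℝ} (hW : AEMeasurable W P) :
    Integrable (fun ω => h (W ω)) P :=
  Integrable.of_bound (hh.contDiff.continuous.comp_aestronglyMeasurable hW.aestronglyMeasurable)
    (supNorm h) (Filter.Eventually.of_forall fun ω => abs_le_supNorm hh.bounded (W ω))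

lemma abs_integral_sub_le {Ω : Type*} [MeasurableSpace Ω] {P : Measure Ω}
    [IsProbabilityMeasure P] {n : ℕ} (hn : 0 < n) {Y : Fin n → Ω → ℝ} (hY : iIndepFun Y P)
    (hlaw : ∀ i, HasLaw (Y i) (gaussianReal 0 1) P) {W : Ω → ℝ} (hW : AEMeasurable W P)
    (hWeq : ∀ᵐ ω ∂P, ((∑ i, Y i ω) / √n) ^ 2 < ∑ i, Y i ω ^ 2 ∧
      W ω = n * Real.log ((∑ i, Y i ω ^ 2) / (∑ i, Y i ω ^ 2 - ((∑ i, Y i ω) / √n) ^ 2)))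
    {h : ℝ → ℝ} (hh : IsCb2 h) :
    |∫ ω, h (W ω) ∂P - ∫ ω, h (((∑ i, Y i ω) / √n) ^ 2) ∂P| ≤
      29 * (supNorm (deriv h) / √n) + 24 * (supNorm h / n) := by
  have hn' : (0 : ℝ) < n := by exact_mod_cast hn
  have hZ := hasLaw_sum_div_sqrt hn hY hlaw
  set Z : Ω → ℝ := fun ω => (∑ i, Y i ω) / √n
  set Q : Ω → ℝ := fun ω => ∑ i, Y i ω ^ 2
  have i1 : Integrable (fun ω => Z ω ^ 4) P := integrable_pow_of_hasLaw hZ 4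
  have i2 : Integrable (fun ω => Z ω ^ 2) P := integrable_pow_of_hasLaw hZ 2
  have i3 : Integrable (fun ω => (Q ω - n) ^ 2) P :=
    ((memLp_sum_sq hlaw).sub (memLp_const _)).integrable_sq
  have e1 : ∫ ω, Z ω ^ 4 ∂P = 3 := integral_pow_four_of_hasLaw hZ
  have e2 : ∫ ω, Z ω ^ 2 ∂P = 1 := integral_sq_of_hasLaw hZ
  have e3 : ∫ ω, (Q ω - n) ^ 2 ∂P = 2 * n := integral_sum_sq_sub_sq hY hlaw
  set D := supNorm (deriv h)
  set H := supNorm h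
  have hD : 0 ≤ D := supNorm_nonneg _
  have hr : 0 < √(n : ℝ) := Real.sqrt_pos.2 hn'
  have iW := hh.integrable_comp hW
  have iZ : Integrable (fun ω => h (Z ω ^ 2)) P :=
    hh.integrable_comp (hZ.aemeasurable.pow_const 2)
  let c1 : ℝ := D * (8 / n + 1 / √n)
  let c2 : ℝ := 8 * H / n
  let c3 : ℝ := D / (n * √n) + 8 * H / n ^ 2
  have key : ∀ᵐ ω ∂P, |h (W ω) - h (Z ω ^ 2)| ≤
      c1 * Z ω ^ 4 + c2 * Z ω ^ 2 + c3 * (Q ω - n) ^ 2 := by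
    filter_upwards [hWeq] with ω ⟨hlt, hω⟩
    rw [hω]
    refine (hh.abs_comp_sub_le hn' (sq_nonneg (Z ω)) hlt).trans (le_of_eq ?_)
    simp only [c1, c2, c3, D, H]
    field_simp
    ring
  calc _ = |∫ ω, (h (W ω) - h (Z ω ^ 2)) ∂P| := by rw [integral_sub iW iZ]
    _ ≤ ∫ ω, |h (W ω) - h (Z ω ^ 2)| ∂P := abs_integral_le_integral_abs
    _ ≤ ∫ ω, (c1 * Z ω ^ 4 + c2 * Z ω ^ 2 + c3 * (Q ω - n) ^ 2) ∂P :=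
        integral_mono_ae (iW.sub iZ).abs
          (((i1.const_mul c1).add (i2.const_mul c2)).add (i3.const_mul c3)) key
    _ = c1 * 3 + c2 * 1 + c3 * (2 * n) := by
        rw [integral_add (f := fun ω => c1 * Z ω ^ 4 + c2 * Z ω ^ 2)
            ((i1.const_mul c1).add (i2.const_mul c2)) (i3.const_mul c3),
          integral_add (i1.const_mul c1) (i2.const_mul c2), integral_const_mul,
          integral_const_mul, integral_const_mul, e1, e2, e3]
    _ = D * (24 / n) + 5 * (D / √n) + 24 * (H / n) := by
        simp only [c1, c2, c3]
        field_simp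
        ring
    -- Since `n ≥ 1`, `√n ≤ n`; the constant `29` is `24 + 5`.
    _ ≤ D * (24 / √n) + 5 * (D / √n) + 24 * (H / n) := by
        have : √(n : ℝ) ≤ n := by
          rw [Real.sqrt_le_left hn'.le]
          have : (1 : ℝ) ≤ n := by exact_mod_cast hn
          nlinarith
        gcongr
    _ = _ := by ring

lemma sum_sub_sampleMean_sq {n : ℕ} (hn : 0 < n) (x : Fin n → ℝ) :
    ∑ i, (x i - sampleMean x) ^ 2 = ∑ i, x i ^ 2 - ((∑ i, x i) / √n) ^ 2 := by
  have hn' : (0 : ℝ) < n := by exact_mod_cast hn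
  have h := sum_sub_sq_eq hn x 0
  simp only [sub_zero] at h
  have e : ((∑ i, x i) / √n) ^ 2 = n * sampleMean x ^ 2 := by
    rw [div_pow, Real.sq_sqrt hn'.le, sampleMean]
    field_simp
  rw [h, e, add_sub_cancel_right]

lemma abs_integral_negTwoLogLambda_sub_le {Ω Ω' : Type*} [MeasurableSpace Ω] [MeasurableSpace Ω']
    {P : Measure Ω} [IsProbabilityMeasure P] {P' : Measure Ω'} [IsProbabilityMeasure P']
    {n : ℕ} (hn : 2 ≤ n) {σ : ℝ} (hσ : 0 < σ) {X : Fin n → Ω → ℝ} (hX : iIndepFun X P)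
    (hlaw : ∀ i, HasLaw (X i) (gaussianReal 0 (σ ^ 2).toNNReal) P)
    {K : Ω' → ℝ} (hK : HasLaw K (chiSquared 1) P') {h : ℝ → ℝ} (hh : IsCb2 h) :
    Integrable (fun ω => h (negTwoLogLambda normalDensity normalParams normalNullParams (0, σ ^ 2)
      (fun i => X i ω))) P ∧
    Integrable (fun ω => h (K ω)) P' ∧
    |(∫ ω, h (negTwoLogLambda normalDensity normalParams normalNullParams (0, σ ^ 2)
      (fun i => X i ω)) ∂P) - ∫ ω, h (K ω) ∂P'| ≤
      29 * (supNorm (deriv h) / √n) + 24 * (supNorm h / n) := by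
  have hn0 : 0 < n := by omega
  have hσ2 : (σ ^ 2).toNNReal ≠ 0 := by simpa using hσ.ne'
  have := nullSingletonClass_gaussianReal (μ := 0) hσ2
  let Y : Fin n → Ω → ℝ := fun i ω => X i ω / σ
  have hY : iIndepFun Y P := hX.comp (fun _ x => x / σ) fun _ => measurable_id.div_const σ
  have hYlaw : ∀ i, HasLaw (Y i) (gaussianReal 0 1) P := fun i => by
    convert! gaussianReal_div_const (hlaw i) σ using 2
    · simp
    · ext
      simp only [NNReal.coe_one, NNReal.coe_div, NNReal.coe_mk, Real.coe_toNNReal _ (sq_nonneg σ)]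
      field_simp
  have hlam : ∀ᵐ ω ∂P, ((∑ i, Y i ω) / √n) ^ 2 < ∑ i, Y i ω ^ 2 ∧
      negTwoLogLambda normalDensity normalParams normalNullParams (0, σ ^ 2) (fun i => X i ω) =
        n * Real.log ((∑ i, Y i ω ^ 2) / (∑ i, Y i ω ^ 2 - ((∑ i, Y i ω) / √n) ^ 2)) := by
    filter_upwards [ae_sum_sub_sampleMean_sq_pos hn hX hlaw] with ω hω
    rw [negTwoLogLambda_normal hn0 _ (sq_pos_of_pos hσ) hω]
    rw [sum_sub_sampleMean_sq hn0] at hω ⊢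
    have e1 : ∑ i, X i ω ^ 2 = σ ^ 2 * ∑ i, Y i ω ^ 2 := by
      rw [Finset.mul_sum]
      refine Finset.sum_congr rfl fun i _ => ?_
      simp only [Y]
      field_simp
    have e2 : ((∑ i, X i ω) / √n) ^ 2 = σ ^ 2 * ((∑ i, Y i ω) / √n) ^ 2 := by
      rw [← mul_pow]
      simp only [Y, ← Finset.sum_div]
      field_simp
    rw [e1, e2, ← mul_sub] at hω ⊢
    refine ⟨?_, by rw [mul_div_mul_left _ _ (pow_ne_zero 2 hσ.ne')]⟩
    linarith [pos_of_mul_pos_right hω (sq_nonneg σ)]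
  have hYm : ∀ i, AEMeasurable (Y i) P := fun i => (hYlaw i).aemeasurable
  -- The maximiser is chosen by `Classical.epsilon`, so measurability comes from the almost sure
  -- closed form.
  have hW : AEMeasurable (fun ω => negTwoLogLambda normalDensity normalParams normalNullParams
      (0, σ ^ 2) (fun i => X i ω)) P := by
    refine AEMeasurable.congr ?_ (hlam.mono fun ω hω => hω.2.symm)
    fun_prop
  have hZ := hasLaw_sum_div_sqrt hn0 hY hYlaw
  have hZ2 : HasLaw (fun ω => ((∑ i, Y i ω) / √n) ^ 2) (chiSquared 1) P :=
    HasLaw.fun_comp (Y := fun x => x ^ 2) ⟨by fun_prop, chiSquared_one.symm⟩ hZ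
  have hKZ : ∫ ω, h (K ω) ∂P' = ∫ ω, h (((∑ i, Y i ω) / √n) ^ 2) ∂P :=
    (hK.integral_comp hh.contDiff.continuous.aestronglyMeasurable).trans
      (hZ2.integral_comp hh.contDiff.continuous.aestronglyMeasurable).symm
  refine ⟨hh.integrable_comp hW, hh.integrable_comp hK.aemeasurable, ?_⟩
  rw [hKZ]
  exact abs_integral_sub_le hn0 hY hYlaw hW hlam hh

end LikelihoodRatio


theorem corollary2 {Ω Ω' : Type*} [MeasurableSpace Ω] [MeasurableSpace Ω']
    (P : Measure Ω) [IsProbabilityMeasure P] (P' : Measure Ω') [IsProbabilityMeasure P']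
    (n : ℕ) (hn : 2 ≤ n) (μ σ : ℝ) (hσ : 0 < σ)
    (X : Fin n → Ω → ℝ) (hX : iIndepFun X P)
    (hlaw : ∀ i, HasLaw (X i) (gaussianReal μ (σ ^ 2).toNNReal) P)
    (K : Ω' → ℝ) (hK : HasLaw K (LikelihoodRatio.chiSquared 1) P') :
    -- the MLE exists, is unique, and has the stated form, over the full and the null parameter set
    (∀ᵐ ω ∂P,
      LikelihoodRatio.mleSet LikelihoodRatio.normalDensity LikelihoodRatio.normalParams
          (fun i => X i ω) =
        {(LikelihoodRatio.sampleMean (fun i => X i ω),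
          (∑ i, (X i ω - LikelihoodRatio.sampleMean (fun j => X j ω)) ^ 2) / n)} ∧
      LikelihoodRatio.mleSet LikelihoodRatio.normalDensity LikelihoodRatio.normalNullParams
          (fun i => X i ω) =
        {((0 : ℝ), (∑ i, X i ω ^ 2) / n)}) ∧
    -- under the null hypothesis, the distance to the chi-square distribution
    ((μ, σ ^ 2) ∈ LikelihoodRatio.normalNullParams →
      ∀ h : ℝ → ℝ, LikelihoodRatio.IsCb2 h →
        Integrable (fun ω => h (LikelihoodRatio.negTwoLogLambda LikelihoodRatio.normalDensity
          LikelihoodRatio.normalParams LikelihoodRatio.normalNullParams (μ, σ ^ 2)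
          (fun i => X i ω))) P ∧
        Integrable (fun ω => h (K ω)) P' ∧
        |(∫ ω, h (LikelihoodRatio.negTwoLogLambda LikelihoodRatio.normalDensity
            LikelihoodRatio.normalParams LikelihoodRatio.normalNullParams (μ, σ ^ 2)
            (fun i => X i ω)) ∂P) - ∫ ω, h (K ω) ∂P'| ≤
          47456 * σ ^ 2 * (LikelihoodRatio.supNorm (deriv (deriv h)) +
              LikelihoodRatio.supNorm (deriv h)) / √(n * Real.pi) * max 1 (σ ^ (-9 : ℤ)) +
            418433114 * (LikelihoodRatio.supNorm (deriv h) / √n) * max 1 (σ ^ 4) +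
            8 * (LikelihoodRatio.supNorm h / n) * (4 + 1 / σ ^ 2)) := by
  have hn0 : 0 < n := by omega
  refine ⟨?_, ?_⟩
  · have hσ2 : (σ ^ 2).toNNReal ≠ 0 := by simpa using hσ.ne'
    have := nullSingletonClass_gaussianReal (μ := μ) hσ2
    filter_upwards [LikelihoodRatio.ae_sum_sub_sampleMean_sq_pos hn hX hlaw] with ω hω
    exact ⟨LikelihoodRatio.mleSet_normalParams hn0 _ hω,
      LikelihoodRatio.mleSet_normalNullParams hn0 _
        (hω.trans_le (LikelihoodRatio.sum_sub_sampleMean_sq_le hn0 _))⟩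
  · rintro ⟨-, h0⟩ h hh
    obtain rfl : μ = 0 := h0
    obtain ⟨i1, i2, hle⟩ := LikelihoodRatio.abs_integral_negTwoLogLambda_sub_le hn hσ hX hlaw hK hh
    refine ⟨i1, i2, hle.trans ?_⟩
    have hD := LikelihoodRatio.supNorm_nonneg (deriv h)
    have hD2 := LikelihoodRatio.supNorm_nonneg (deriv (deriv h))
    have hH := LikelihoodRatio.supNorm_nonneg h
    -- The first term of the bound is needed only to be nonnegative; the other two absorb the error,
    -- with `24 ≤ 8 * 4` for the last.
    have b1 : 0 ≤ 47456 * σ ^ 2 * (LikelihoodRatio.supNorm (deriv (deriv h)) +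
        LikelihoodRatio.supNorm (deriv h)) / √(n * Real.pi) * max 1 (σ ^ (-9 : ℤ)) := by
      positivity
    have hDn : 0 ≤ LikelihoodRatio.supNorm (deriv h) / √n := by positivity
    have hHn : 0 ≤ LikelihoodRatio.supNorm h / n := by positivity
    have b2 : 29 * (LikelihoodRatio.supNorm (deriv h) / √n) ≤
        418433114 * (LikelihoodRatio.supNorm (deriv h) / √n) * max 1 (σ ^ 4) := by
      calc _ ≤ 418433114 * (LikelihoodRatio.supNorm (deriv h) / √n) * 1 := by linarith
        _ ≤ _ := by
          gcongr
          exact le_max_left _ _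
    have b3 : 24 * (LikelihoodRatio.supNorm h / n) ≤
        8 * (LikelihoodRatio.supNorm h / n) * (4 + 1 / σ ^ 2) := by
      have : 0 ≤ 1 / σ ^ 2 := by positivity
      calc _ ≤ 8 * (LikelihoodRatio.supNorm h / n) * 4 := by linarith
        _ ≤ _ := by
          gcongr
          linarith
    linarith
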